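/- For positive integers $d_1,d_2$ let $K$ be the set of real $d_1\times d_2$ matrices with nuclear norm at most $1$. A real $d_1\times d_2$ matrix $X$ determines outcomes of comparisons (Bradley--Terry--Luce model): for $1\le i\le d_1$ and $1\le j,k\le d_2$, the outcome $Y_{ijk}\in\{-1,1\}$ equals $1$ with probability $e^{x}/(1+e^{x})$, where $x=X_{ij}-X_{ik}$, and the outcomes of different comparisons are independent; $\mathbb E_X$ is the corresponding expectation. Let $\mathbb P_{X,m}$ be the law of the comparisons and outcomes observed in a uniform sample of size $m$, in either of the following senses: (a) $m$ is real, $\Omega$ is a random set of triples $(i,j,k)$ with any law (not depending on $X$) for which every triple belongs to $\Omega$ with probability $m/(d_1d_2^2)$ (for example independently of the other triples, or $\Omega$ is a uniformly random set of exactly $m$ triples), and $\Omega$ together with $(Y_{ijk})_{(i,j,k)\in\Omega}$ is observed, with $\Omega$ independent of $Y$; (b) $m\ge 0$ is an integer, and $m$ independent uniformly random triples are observed, each with its own independent outcome. There are universal constants $0<c<C$ such that the following holds. Let $\mathcal L:\mathbb R\to\mathbb R$ be differentiable at $0$ with $\mathcal L'(0)<0$. Then there is $\gamma_0>0$, depending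 only on $\mathcal L$, such that for all $0<\gamma<\gamma_0$, all $\lambda>0$ and all integers $d_1,d_2$ with $d_2\ge2$ for which $B:=\lambda\gamma^{-2}$ is an integer with $B\le d_1$, there is a finite set $\mathcal X\subset\sqrt{\lambda d_1d_2}\,K$ of at least $\exp(cBd_2)$ real $d_1\times d_2$ matrices such that for any two distinct $X^1,X^2\in\mathcal X$ $$\frac1{d_1d_2^2}\sum_{i=1}^{d_1}\sum_{j,k=1}^{d_2}\mathbb E_{X^1}\big[\mathcal L(Y_{ijk}(X^2_{ij}-X^2_{ik}))-\mathcal L(Y_{ijk}(X^1_{ij}-X^1_{ik}))\big]\ \ge\ c\,|\mathcal L'(0)|\,\gamma^2,$$ and for all $X^1,X^2\in\mathcal X$, in each of the senses (a) and (b) and for every $m$, $$D(\mathbb P_{X^1,m}\,\|\,\mathbb P_{X^2,m})\le C\,m\,\gamma^2,$$ where $D$ is the Kullback--Leibler divergence. -/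

import Mathlib

open MeasureTheory ProbabilityTheory InformationTheory
open scoped ENNReal Pointwise

noncomputable section

/-- A comparison `(i, j, k)`: user `i` compares item `j` with item `k`. -/
abbrev Triple (d₁ d₂ : ℕ) : Type := Fin d₁ × Fin d₂ × Fin d₂

/-- The score difference `X i j - X i k` of a comparison `(i, j, k)`. -/
def scoreDiff {d₁ d₂ : ℕ} (X : Matrix (Fin d₁) (Fin d₂) ℝ) (t : Triple d₁ d₂) : ℝ :=
  X t.1 t.2.1 - X t.1 t.2.2

/-- The nuclear norm of a real matrix: the sum of its singular values. -/
def nuclearNorm {d₁ d₂ : ℕ} (X : Matrix (Fin d₁) (Fin d₂) ℝ) : ℝ :=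
  ∑ l ∈ Finset.range d₂, (Matrix.toEuclideanLin X).singularValues l

/-- The unit ball `K` of the nuclear norm. -/
def nuclearBall (d₁ d₂ : ℕ) : Set (Matrix (Fin d₁) (Fin d₂) ℝ) :=
  {X | nuclearNorm X ≤ 1}

/-- The Bradley-Terry-Luce law of the outcome of the comparison `t` under the score matrix `X`:
the outcome is `1` with probability `exp x / (1 + exp x)`, where `x` is the score difference, and
`-1` otherwise. -/
def outcomeLaw {d₁ d₂ : ℕ} (X : Matrix (Fin d₁) (Fin d₂) ℝ) (t : Triple d₁ d₂) : Measure ℤ :=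
  bernoulliMeasure (1 : ℤ) (-1) (unitInterval.sigmoid (scoreDiff X t))

/-- The excess expected loss of `X₂` over `X₁`, averaged over all comparisons `(i, j, k)`, when the
outcomes are drawn under `X₁`. -/
def averageExcessLoss {d₁ d₂ : ℕ} (L : ℝ → ℝ) (X₁ X₂ : Matrix (Fin d₁) (Fin d₂) ℝ) : ℝ :=
  1 / ((d₁ : ℝ) * (d₂ : ℝ) ^ 2) * ∑ i : Fin d₁, ∑ j : Fin d₂, ∑ k : Fin d₂,
    ∫ y, (L ((y : ℝ) * (X₂ i j - X₂ i k)) - L ((y : ℝ) * (X₁ i j - X₁ i k)))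
      ∂(outcomeLaw X₁ (i, j, k))

/-- The law `ν` of a random set of comparisons is uniform with (expected) sample size `m` if every
comparison belongs to the random set with probability `m / (d₁ d₂²)`. Taking all comparisons
independently with this probability, or a uniformly random set of exactly `m` comparisons,
are examples. -/
def IsUniformSetSampling {d₁ d₂ : ℕ} (ν : Measure (Set (Triple d₁ d₂))) (m : ℝ) : Prop :=
  IsProbabilityMeasure ν ∧
    ∀ t : Triple d₁ d₂, ν.real {Ω | t ∈ Ω} = m / ((d₁ : ℝ) * (d₂ : ℝ) ^ 2)

/-- The law of the data `(Ω, (Y t)_{t ∈ Ω})` under `X`, where `Ω` has law `ν` and is independent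
of the independent outcomes `Y`. Unobserved outcomes are recorded as `0`. -/
def setSampleLaw {d₁ d₂ : ℕ} (ν : Measure (Set (Triple d₁ d₂)))
    (X : Matrix (Fin d₁) (Fin d₂) ℝ) : Measure (Set (Triple d₁ d₂) × (Triple d₁ d₂ → ℤ)) :=
  (ν.prod (Measure.pi (outcomeLaw X))).map (fun p => (p.1, p.1.indicator p.2))

/-- The law under `X` of one uniformly random comparison together with its outcome. -/
def singleSampleLaw {d₁ d₂ : ℕ} (X : Matrix (Fin d₁) (Fin d₂) ℝ) :
    Measure (Triple d₁ d₂ × ℤ) :=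
  ∑ t : Triple d₁ d₂,
    (Fintype.card (Triple d₁ d₂) : ℝ≥0∞)⁻¹ • (Measure.dirac t).prod (outcomeLaw X t)

/-- The law under `X` of `m` independent uniformly random comparisons with their outcomes. -/
def iidSampleLaw {d₁ d₂ : ℕ} (m : ℕ) (X : Matrix (Fin d₁) (Fin d₂) ℝ) :
    Measure (Fin m → Triple d₁ d₂ × ℤ) :=
  Measure.pi (fun _ => singleSampleLaw X)

end

/-
The family consists of sign matrices `±γ` with only `B` distinct rows, so that their rank is at most
`B` and their nuclear norm is at most `√(B γ² d₁ d₂) = √(λ d₁ d₂)`. Every row carries a code word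
next to its negative, hence all row sums agree, and a Gilbert-Varshamov code separates the matrices
in Frobenius norm.

On score differences in `{0, 2γ, -2γ}` both the loss and the logistic function are quadratic
polynomials. The balanced rows cancel the quadratic part of the loss, so the excess loss is exactly
a multiple of the squared Frobenius distance. The multiple is governed by the symmetric difference
quotients of the loss and of the logistic function at step `2γ`, which tend to `L'(0)` and `1/4`.

The chain rule reduces the divergence of the samples to single comparisons. There
`KL(P ‖ Q) ≤ KL(P ‖ Q) + KL(Q ‖ P) = (x - y) (σ x - σ y)`, because two Bernoulli laws on
the same points are exponential tiltings of each other, and this is at most `(x - y)² / 4`.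
-/

lemma klDiv_map_measurableEquiv {α β : Type*} [MeasurableSpace α] [MeasurableSpace β]
    (μ ν : Measure α) [IsFiniteMeasure μ] [IsFiniteMeasure ν] (e : α ≃ᵐ β) :
    klDiv (μ.map e) (ν.map e) = klDiv μ ν := by
  refine (klDiv_map_le _ _ e.measurable).antisymm ?_
  simpa only [MeasurableEquiv.map_symm_map] using
    klDiv_map_le (μ.map e) (ν.map e) e.symm.measurable

lemma klDiv_prod {α β : Type*} [MeasurableSpace α] [MeasurableSpace β] (μ₁ ν₁ : Measure α)
    (μ₂ ν₂ : Measure β) [IsProbabilityMeasure μ₁] [IsFiniteMeasure ν₁] [IsProbabilityMeasure μ₂]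
    [IsProbabilityMeasure ν₂] :
    klDiv (μ₁.prod μ₂) (ν₁.prod ν₂) = klDiv μ₁ ν₁ + klDiv μ₂ ν₂ := by
  have hsnd : klDiv (μ₁.prod μ₂) (μ₁.prod ν₂) = klDiv μ₂ ν₂ := by
    rw [← Measure.prod_swap (μ := μ₂), ← Measure.prod_swap (μ := ν₂)]
    refine (klDiv_map_measurableEquiv _ _ MeasurableEquiv.prodComm).trans ?_
    simpa only [Measure.compProd_const] using klDiv_compProd_left μ₂ ν₂ (Kernel.const β μ₁)
  rw [← hsnd]
  simpa only [Measure.compProd_const] using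
    klDiv_compProd_eq_add μ₁ ν₁ (Kernel.const α μ₂) (Kernel.const α ν₂)

lemma klDiv_pi {ι : Type*} [Fintype ι] {α : ι → Type*} [∀ i, MeasurableSpace (α i)]
    (μ ν : ∀ i, Measure (α i)) [∀ i, IsProbabilityMeasure (μ i)]
    [∀ i, IsProbabilityMeasure (ν i)] :
    klDiv (Measure.pi μ) (Measure.pi ν) = ∑ i, klDiv (μ i) (ν i) := by
  revert α
  refine Fintype.induction_empty_option (P := fun ι _ => ∀ {α : ι → Type _}
    [∀ i, MeasurableSpace (α i)] (μ ν : ∀ i, Measure (α i)) [∀ i, IsProbabilityMeasure (μ i)]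
    [∀ i, IsProbabilityMeasure (ν i)],
    klDiv (Measure.pi μ) (Measure.pi ν) = ∑ i, klDiv (μ i) (ν i)) ?_ ?_ ?_ ι
  · intro ι κ _ e ih α _ μ ν _ _
    let := Fintype.ofEquiv κ e.symm
    rw [← (measurePreserving_piCongrLeft μ e).map_eq, ← (measurePreserving_piCongrLeft ν e).map_eq,
      klDiv_map_measurableEquiv, ih, e.sum_comp fun i => klDiv (μ i) (ν i)]
  · intro α _ μ ν _ _
    simp [Subsingleton.elim μ ν]
  · intro ι _ ih α _ μ ν _ _
    rw [← Measure.pi_map_piOptionEquivProd μ, ← Measure.pi_map_piOptionEquivProd ν,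
      klDiv_map_measurableEquiv, klDiv_prod, ih, Fintype.sum_option, add_comm]

lemma rnDeriv_compProd_right {α β : Type*} [MeasurableSpace α] [MeasurableSpace β]
    [MeasurableSpace.CountableOrCountablyGenerated α β] {μ : Measure α} [IsFiniteMeasure μ]
    {κ η : Kernel α β} [IsFiniteKernel κ] [IsFiniteKernel η] (hκη : ∀ᵐ a ∂μ, κ a ≪ η a) :
    (μ ⊗ₘ κ).rnDeriv (μ ⊗ₘ η) =ᵐ[μ ⊗ₘ η] fun p => κ.rnDeriv η p.1 p.2 := by
  have hdensity : μ ⊗ₘ κ = (μ ⊗ₘ η).withDensity fun p => κ.rnDeriv η p.1 p.2 := by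
    rw [← Measure.compProd_withDensity (κ.measurable_rnDeriv η)]
    refine Measure.compProd_congr ?_
    filter_upwards [hκη] with a ha
    exact (Kernel.withDensity_rnDeriv_eq ha).symm
  rw [hdensity]
  exact Measure.rnDeriv_withDensity _ (κ.measurable_rnDeriv η)

lemma klDiv_compProd_right_of_ac {α β : Type*} [MeasurableSpace α] [MeasurableSpace β]
    [MeasurableSpace.CountableOrCountablyGenerated α β] {μ : Measure α} [IsFiniteMeasure μ]
    {κ η : Kernel α β} [IsFiniteKernel κ] [IsFiniteKernel η] (hκη : ∀ᵐ a ∂μ, κ a ≪ η a) :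
    klDiv (μ ⊗ₘ κ) (μ ⊗ₘ η) = ∫⁻ a, klDiv (κ a) (η a) ∂μ := by
  rw [klDiv_eq_lintegral_klFun_of_ac (Measure.absolutelyContinuous_compProd_right_iff.2 hκη)]
  calc _ = ∫⁻ p, ENNReal.ofReal (klFun (κ.rnDeriv η p.1 p.2).toReal) ∂(μ ⊗ₘ η) :=
        lintegral_congr_ae <| by
          filter_upwards [rnDeriv_compProd_right hκη] with p hp
          rw [hp]
    _ = ∫⁻ a, ∫⁻ b, ENNReal.ofReal (klFun (κ.rnDeriv η a b).toReal) ∂η a ∂μ :=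
        Measure.lintegral_compProd (by fun_prop)
    _ = _ := lintegral_congr_ae <| by
        filter_upwards [hκη] with a ha
        rw [klDiv_eq_lintegral_klFun_of_ac ha]
        refine lintegral_congr_ae ?_
        filter_upwards [Kernel.rnDeriv_eq_rnDeriv_measure (κ := κ) (η := η) (a := a)] with b hb
        rw [hb]

lemma klDiv_compProd_right {α β : Type*} [MeasurableSpace α] [MeasurableSpace β]
    [Countable α] [MeasurableSingletonClass α] (μ : Measure α) [IsFiniteMeasure μ]
    (κ η : Kernel α β) [IsFiniteKernel κ] [IsFiniteKernel η] :
    klDiv (μ ⊗ₘ κ) (μ ⊗ₘ η) = ∫⁻ a, klDiv (κ a) (η a) ∂μ := by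
  by_cases hκη : ∀ᵐ a ∂μ, κ a ≪ η a
  · exact klDiv_compProd_right_of_ac hκη
  rw [klDiv_of_not_ac fun h => hκη (Measure.absolutelyContinuous_compProd_right_iff.1 h)]
  by_contra hne
  refine hκη ?_
  filter_upwards [ae_lt_top (.of_discrete) (Ne.symm hne)] with a ha
  exact (klDiv_ne_top_iff.1 ha.ne).1

section RandomMask

lemma measurable_set_indicator {ι β : Type*} [Zero β] [MeasurableSpace β] (Ω : Set ι) :
    Measurable (Ω.indicator : (ι → β) → ι → β) := by
  classical
  refine measurable_pi_lambda _ fun t => ?_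
  by_cases ht : t ∈ Ω
  · simpa only [Set.indicator_of_mem ht] using measurable_pi_apply t
  · simpa only [Set.indicator_of_notMem ht] using measurable_const

variable {ι β : Type*} [Fintype ι] [Zero β] [MeasurableSpace β] (P Q : ι → Measure β)

/-- The conditional law of the observed outcomes given the set `Ω` of observed indices: independent
outcomes with laws `P t` at the indices `t ∈ Ω`, and `0` at the other indices. -/
noncomputable def maskedKernel : Kernel (Set ι) (ι → β) :=
  Kernel.ofFunOfCountable fun Ω => (Measure.pi P).map Ω.indicator

lemma maskedKernel_apply (Ω : Set ι) : maskedKernel P Ω = (Measure.pi P).map Ω.indicator := rfl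

variable [∀ t, IsProbabilityMeasure (P t)] [∀ t, IsProbabilityMeasure (Q t)]

instance : IsMarkovKernel (maskedKernel P) :=
  ⟨fun Ω => Measure.isProbabilityMeasure_map (measurable_set_indicator Ω).aemeasurable⟩

lemma map_indicator_prod_pi (ν : Measure (Set ι)) [SFinite ν] :
    (ν.prod (Measure.pi P)).map (fun p => (p.1, p.1.indicator p.2)) = ν ⊗ₘ maskedKernel P := by
  have hmeas : Measurable fun p : Set ι × (ι → β) => (p.1, p.1.indicator p.2) :=
    measurable_fst.prodMk (measurable_from_prod_countable_right measurable_set_indicator)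
  ext s hs
  rw [Measure.map_apply hmeas hs, Measure.prod_apply (hmeas hs), Measure.compProd_apply hs]
  refine lintegral_congr fun Ω => ?_
  rw [maskedKernel_apply, Measure.map_apply (measurable_set_indicator Ω)
    (measurable_prodMk_left hs)]
  rfl

lemma klDiv_maskedKernel (Ω : Set ι) :
    klDiv (maskedKernel P Ω) (maskedKernel Q Ω) =
      ∑ t, Ω.indicator (fun t => klDiv (P t) (Q t)) t := by
  classical
  let reveal (t : ι) (y : β) : β := if t ∈ Ω then y else 0
  have hreveal (t : ι) : Measurable (reveal t) := by
    by_cases ht : t ∈ Ω <;> simp only [reveal, ht, if_true, if_false] <;> fun_prop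
  have hpi (R : ι → Measure β) [∀ t, IsProbabilityMeasure (R t)] :
      maskedKernel R Ω = Measure.pi fun t => (R t).map (reveal t) := by
    have (t : ι) := Measure.isProbabilityMeasure_map (μ := R t) (hreveal t).aemeasurable
    rw [← Measure.pi_map_pi fun t => (hreveal t).aemeasurable]
    rfl
  have (R : ι → Measure β) [∀ t, IsProbabilityMeasure (R t)] (t : ι) :
      IsProbabilityMeasure ((R t).map (reveal t)) :=
    Measure.isProbabilityMeasure_map (hreveal t).aemeasurable
  rw [hpi P, hpi Q, klDiv_pi]
  refine Finset.sum_congr rfl fun t _ => ?_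
  by_cases ht : t ∈ Ω <;> simp [reveal, ht, Measure.map_const]

lemma klDiv_map_indicator_prod_pi (ν : Measure (Set ι)) [IsFiniteMeasure ν] :
    klDiv ((ν.prod (Measure.pi P)).map fun p => (p.1, p.1.indicator p.2))
        ((ν.prod (Measure.pi Q)).map fun p => (p.1, p.1.indicator p.2)) =
      ∑ t, ν {Ω | t ∈ Ω} * klDiv (P t) (Q t) := by
  rw [map_indicator_prod_pi, map_indicator_prod_pi, klDiv_compProd_right]
  simp_rw [klDiv_maskedKernel]
  rw [lintegral_finsetSum _ fun t _ => .of_discrete]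
  refine Finset.sum_congr rfl fun t _ => ?_
  rw [mul_comm, ← lintegral_indicator_const .of_discrete]
  rfl

end RandomMask

lemma klDiv_tilted_add_klDiv_tilted_right {α : Type*} [MeasurableSpace α] {μ : Measure α}
    [IsProbabilityMeasure μ] {f : α → ℝ} (hexp : Integrable (fun x => Real.exp (f x)) μ)
    (hf : Integrable f μ) (hf' : Integrable f (μ.tilted f)) :
    klDiv (μ.tilted f) μ + klDiv μ (μ.tilted f) =
      ENNReal.ofReal (∫ x, f x ∂(μ.tilted f) - ∫ x, f x ∂μ) := by
  have := isProbabilityMeasure_tilted hexp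
  have hac := tilted_absolutelyContinuous μ f
  have hac' := absolutelyContinuous_tilted hexp
  set Λ := Real.log (∫ x, Real.exp (f x) ∂μ)
  have hllr : llr (μ.tilted f) μ =ᵐ[μ] fun x => f x - Λ := log_rnDeriv_tilted_left_self hexp
  have hllr' : llr μ (μ.tilted f) =ᵐ[μ] fun x => Λ - f x := by
    filter_upwards [hllr, neg_llr hac'] with x hx hx'
    rw [← neg_sub, ← hx, ← hx', Pi.neg_apply, neg_neg]
  have hint : Integrable (llr (μ.tilted f) μ) (μ.tilted f) :=
    (hf'.sub (integrable_const Λ)).congr (hac.ae_eq hllr).symm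
  have hint' : Integrable (llr μ (μ.tilted f)) μ :=
    ((integrable_const Λ).sub hf).congr hllr'.symm
  have hfin := klDiv_ne_top hac hint
  have hfin' := klDiv_ne_top hac' hint'
  rw [← ENNReal.ofReal_toReal (ENNReal.add_ne_top.2 ⟨hfin, hfin'⟩), ENNReal.toReal_add hfin hfin',
    toReal_klDiv_of_measure_eq hac (by simp), toReal_klDiv_of_measure_eq hac' (by simp),
    integral_congr_ae (hac.ae_eq hllr), integral_congr_ae hllr',
    integral_sub hf' (integrable_const Λ), integral_sub (integrable_const Λ) hf]
  simp

lemma withDensity_dirac {α : Type*} [MeasurableSpace α] [MeasurableSingletonClass α] (a : α)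
    (g : α → ℝ≥0∞) : (Measure.dirac a).withDensity g = g a • Measure.dirac a := by
  classical
  ext s hs
  rw [withDensity_apply _ hs, setLIntegral_dirac, Measure.smul_apply, Measure.dirac_apply' _ hs]
  by_cases ha : a ∈ s <;> simp [ha]

lemma bernoulliMeasure_eq_ofReal_smul_dirac {α : Type*} [MeasurableSpace α] (a b : α)
    (p : unitInterval) : bernoulliMeasure a b p =
      ENNReal.ofReal p • Measure.dirac a + ENNReal.ofReal (1 - p) • Measure.dirac b := by
  rw [bernoulliMeasure_def, ENNReal.smul_def, ENNReal.smul_def, ENNReal.ofReal, ENNReal.ofReal,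
    Real.toNNReal_of_nonneg p.2.1, Real.toNNReal_of_nonneg (sub_nonneg.2 p.2.2)]
  rfl

lemma bernoulliMeasure_sigmoid_tilted {α : Type*} [MeasurableSpace α] [MeasurableSingletonClass α]
    (a b : α) (x : ℝ) (f : α → ℝ) :
    (bernoulliMeasure a b (unitInterval.sigmoid x)).tilted f =
      bernoulliMeasure a b (unitInterval.sigmoid (x + (f a - f b))) := by
  set p := Real.sigmoid x
  set q := Real.sigmoid (x + (f a - f b))
  set Z := p * Real.exp (f a) + (1 - p) * Real.exp (f b) with hZ
  have hp : 0 < p := Real.sigmoid_pos x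
  have hp' : 0 < 1 - p := sub_pos.2 (Real.sigmoid_lt_one x)
  have hZpos : 0 < Z := by positivity
  have hpq : p * (Real.exp (f a) / Z) = q := by
    have hodds : 1 - p = p * Real.exp (-x) := by
      rw [Real.sigmoid_mul_rexp_neg, Real.sigmoid_neg]
    change _ = Real.sigmoid (x + (f a - f b))
    rw [hZ, hodds, Real.sigmoid_def (x + _), neg_add, neg_sub, Real.exp_add, Real.exp_sub]
    field_simp
  have hpq' : (1 - p) * (Real.exp (f b) / Z) = 1 - q := by
    rw [← hpq, eq_sub_iff_add_eq, ← mul_div_assoc, ← mul_div_assoc, ← add_div, add_comm,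
      div_self hZpos.ne']
  have hint : ∫ y, Real.exp (f y) ∂bernoulliMeasure a b (unitInterval.sigmoid x) = Z :=
    integral_bernoulliMeasure ..
  rw [Measure.tilted, hint, bernoulliMeasure_eq_ofReal_smul_dirac,
    bernoulliMeasure_eq_ofReal_smul_dirac, withDensity_add_measure, withDensity_smul_measure,
    withDensity_smul_measure, withDensity_dirac, withDensity_dirac, smul_smul, smul_smul]
  change (ENNReal.ofReal p * _) • _ + (ENNReal.ofReal (1 - p) * _) • _ =
    ENNReal.ofReal q • _ + ENNReal.ofReal (1 - q) • _
  rw [← ENNReal.ofReal_mul hp.le, ← ENNReal.ofReal_mul hp'.le, hpq, hpq']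

lemma lipschitzWith_sigmoid : LipschitzWith (1 / 4) Real.sigmoid := by
  refine lipschitzWith_of_nnnorm_deriv_le differentiable_sigmoid fun x => ?_
  have hpos := mul_pos (Real.sigmoid_pos x) (sub_pos.2 (Real.sigmoid_lt_one x))
  rw [← NNReal.coe_le_coe, coe_nnnorm, Real.deriv_sigmoid, Real.norm_of_nonneg hpos.le]
  push_cast
  nlinarith [sq_nonneg (2 * Real.sigmoid x - 1)]

lemma klDiv_bernoulliMeasure_sigmoid_le {α : Type*} [MeasurableSpace α]
    [MeasurableSingletonClass α] {a b : α} (hab : a ≠ b) (x y : ℝ) :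
    klDiv (bernoulliMeasure a b (unitInterval.sigmoid x))
      (bernoulliMeasure a b (unitInterval.sigmoid y)) ≤ ENNReal.ofReal ((x - y) ^ 2 / 4) := by
  classical
  let f : α → ℝ := fun z => if z = a then x - y else 0
  have htilt : (bernoulliMeasure a b (unitInterval.sigmoid y)).tilted f =
      bernoulliMeasure a b (unitInterval.sigmoid x) := by
    rw [bernoulliMeasure_sigmoid_tilted]
    simp [f, hab.symm]
  have hmean (z : ℝ) : ∫ w, f w ∂bernoulliMeasure a b (unitInterval.sigmoid z) =
      Real.sigmoid z * (x - y) := by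
    rw [integral_bernoulliMeasure]
    simp only [f, if_true, hab.symm, if_false, smul_zero, add_zero]
    rfl
  have hJ := klDiv_tilted_add_klDiv_tilted_right (f := f)
    (integrable_bernoulliMeasure _ _ (unitInterval.sigmoid y) _)
    (integrable_bernoulliMeasure ..) (by rw [htilt]; exact integrable_bernoulliMeasure ..)
  rw [htilt, hmean, hmean, ← sub_mul] at hJ
  refine (le_self_add.trans_eq hJ).trans (ENNReal.ofReal_le_ofReal ?_)
  have hlip := lipschitzWith_sigmoid.dist_le_mul x y
  rw [Real.dist_eq, Real.dist_eq] at hlip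
  calc _ ≤ |Real.sigmoid x - Real.sigmoid y| * |x - y| := by
        rw [← abs_mul]; exact le_abs_self _
    _ ≤ (1 / 4 * |x - y|) * |x - y| := by
        gcongr
        simpa using hlip
    _ = (x - y) ^ 2 / 4 := by rw [mul_assoc, abs_mul_abs_self]; ring

lemma uniformOn_univ_singleton {α : Type*} [Fintype α] [MeasurableSpace α]
    [MeasurableSingletonClass α] (a : α) :
    uniformOn Set.univ {a} = (Fintype.card α : ℝ≥0∞)⁻¹ := by
  rw [uniformOn_univ, Measure.count_singleton, one_div]

section SampleLaws

variable {d₁ d₂ : ℕ} (X X₁ X₂ : Matrix (Fin d₁) (Fin d₂) ℝ)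

instance (t : Triple d₁ d₂) : IsProbabilityMeasure (outcomeLaw X t) := by
  unfold outcomeLaw
  infer_instance

lemma klDiv_outcomeLaw_le (t : Triple d₁ d₂) :
    klDiv (outcomeLaw X₁ t) (outcomeLaw X₂ t) ≤
      ENNReal.ofReal ((scoreDiff X₁ t - scoreDiff X₂ t) ^ 2 / 4) :=
  klDiv_bernoulliMeasure_sigmoid_le (by norm_num) _ _

lemma klDiv_setSampleLaw {ν : Measure (Set (Triple d₁ d₂))} {m : ℝ}
    (hν : IsUniformSetSampling ν m) :
    klDiv (setSampleLaw ν X₁) (setSampleLaw ν X₂) =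
      ENNReal.ofReal (m / (d₁ * d₂ ^ 2)) * ∑ t, klDiv (outcomeLaw X₁ t) (outcomeLaw X₂ t) := by
  have := hν.1
  rw [setSampleLaw, setSampleLaw, klDiv_map_indicator_prod_pi, Finset.mul_sum]
  refine Finset.sum_congr rfl fun t _ => ?_
  rw [← hν.2 t, ofReal_measureReal]

/-- The conditional law of the outcome given which comparison is made. -/
noncomputable def outcomeKernel : Kernel (Triple d₁ d₂) ℤ :=
  Kernel.ofFunOfCountable (outcomeLaw X)

lemma outcomeKernel_apply (t : Triple d₁ d₂) : outcomeKernel X t = outcomeLaw X t := rfl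

instance : IsMarkovKernel (outcomeKernel X) :=
  ⟨fun t => inferInstanceAs (IsProbabilityMeasure (outcomeLaw X t))⟩

lemma singleSampleLaw_eq_compProd :
    singleSampleLaw X = uniformOn Set.univ ⊗ₘ outcomeKernel X := by
  ext s hs
  rw [singleSampleLaw, Measure.finsetSum_apply, Measure.compProd_apply hs, lintegral_fintype]
  refine Finset.sum_congr rfl fun t _ => ?_
  rw [Measure.smul_apply, Measure.prod_apply hs, lintegral_dirac, outcomeKernel_apply,
    uniformOn_univ_singleton, smul_eq_mul, mul_comm]

instance [Nonempty (Triple d₁ d₂)] : IsProbabilityMeasure (singleSampleLaw X) := by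
  have := isProbabilityMeasure_uniformOn Set.finite_univ (Set.univ_nonempty (α := Triple d₁ d₂))
  rw [singleSampleLaw_eq_compProd]
  infer_instance

lemma klDiv_singleSampleLaw :
    klDiv (singleSampleLaw X₁) (singleSampleLaw X₂) =
      (Fintype.card (Triple d₁ d₂) : ℝ≥0∞)⁻¹ *
        ∑ t, klDiv (outcomeLaw X₁ t) (outcomeLaw X₂ t) := by
  rw [singleSampleLaw_eq_compProd, singleSampleLaw_eq_compProd, klDiv_compProd_right,
    lintegral_fintype, Finset.mul_sum]
  refine Finset.sum_congr rfl fun t _ => ?_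
  rw [uniformOn_univ_singleton, outcomeKernel_apply, outcomeKernel_apply, mul_comm]

lemma klDiv_iidSampleLaw [Nonempty (Triple d₁ d₂)] (m : ℕ) :
    klDiv (iidSampleLaw m X₁) (iidSampleLaw m X₂) =
      ENNReal.ofReal (m / (d₁ * d₂ ^ 2)) * ∑ t, klDiv (outcomeLaw X₁ t) (outcomeLaw X₂ t) := by
  have hcard : ENNReal.ofReal (m / (d₁ * d₂ ^ 2)) = m * (Fintype.card (Triple d₁ d₂) : ℝ≥0∞)⁻¹ := by
    have hpos : (0 : ℝ) < Fintype.card (Triple d₁ d₂) := by exact_mod_cast Fintype.card_pos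
    rw [← ENNReal.ofReal_natCast m, ← ENNReal.ofReal_natCast (Fintype.card _),
      ← div_eq_mul_inv, ← ENNReal.ofReal_div_of_pos hpos]
    simp [sq]
  rw [iidSampleLaw, iidSampleLaw, klDiv_pi, Finset.sum_const, Finset.card_fin,
    klDiv_singleSampleLaw, nsmul_eq_mul, hcard, mul_assoc]

variable {X₁ X₂}

lemma mul_sum_klDiv_outcomeLaw_le [NeZero d₁] [NeZero d₂] {γ : ℝ} (hX₁ : ∀ i j, |X₁ i j| ≤ γ)
    (hX₂ : ∀ i j, |X₂ i j| ≤ γ) (m : ℝ) :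
    ENNReal.ofReal (m / (d₁ * d₂ ^ 2)) * ∑ t, klDiv (outcomeLaw X₁ t) (outcomeLaw X₂ t) ≤
      ENNReal.ofReal (4 * m * γ ^ 2) := by
  have hdiff (t : Triple d₁ d₂) : (scoreDiff X₁ t - scoreDiff X₂ t) ^ 2 ≤ (4 * γ) ^ 2 := by
    refine sq_le_sq' ?_ ?_ <;>
    · simp only [scoreDiff]
      linarith [abs_le.1 (hX₁ t.1 t.2.1), abs_le.1 (hX₁ t.1 t.2.2), abs_le.1 (hX₂ t.1 t.2.1),
        abs_le.1 (hX₂ t.1 t.2.2)]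
  have hsum : ∑ t, klDiv (outcomeLaw X₁ t) (outcomeLaw X₂ t) ≤
      ENNReal.ofReal (d₁ * d₂ ^ 2 * (4 * γ ^ 2)) := by
    calc _ ≤ ∑ _t : Triple d₁ d₂, ENNReal.ofReal (4 * γ ^ 2) := by
          refine Finset.sum_le_sum fun t _ => (klDiv_outcomeLaw_le X₁ X₂ t).trans ?_
          exact ENNReal.ofReal_le_ofReal (by linarith [hdiff t])
      _ = _ := by
          rw [← ENNReal.ofReal_sum_of_nonneg fun _ _ => by positivity]
          simp [sq]
  calc _ ≤ ENNReal.ofReal (m / (d₁ * d₂ ^ 2)) * ENNReal.ofReal (d₁ * d₂ ^ 2 * (4 * γ ^ 2)) := by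
        gcongr
    _ = ENNReal.ofReal (4 * m * γ ^ 2) := by
        rw [← ENNReal.ofReal_mul' (by positivity)]
        have := NeZero.ne (d₁ : ℝ)
        have := NeZero.ne (d₂ : ℝ)
        congr 1
        field_simp

end SampleLaws

section GilbertVarshamov

variable {ι : Type*} [Fintype ι] {β : ι → Type*} [∀ i, DecidableEq (β i)]

variable (β) in
lemma exists_hammingDist_packing_and_cover [∀ i, Finite (β i)] (r : ℕ) :
    ∃ F : Finset (∀ i, β i), (F : Set (∀ i, β i)).Pairwise (fun x y => r < hammingDist x y) ∧
      ∀ z, ∃ x ∈ F, hammingDist x z ≤ r := by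
  classical
  obtain ⟨F, hF⟩ := (Set.toFinite {F : Finset (∀ i, β i) |
    (F : Set (∀ i, β i)).Pairwise fun x y => r < hammingDist x y}).exists_maximal ⟨∅, by simp⟩
  refine ⟨F, hF.prop, fun z => ?_⟩
  by_contra! hz
  have hins :
        ((insert z F : Finset _) : Set (∀ i, β i)).Pairwise fun x y => r < hammingDist x y := by
    rw [Finset.coe_insert]
    exact hF.prop.insert fun y hy _ => ⟨hammingDist_comm y z ▸ hz y hy, hz y hy⟩
  have hzF : z ∈ F := hF.le_of_ge hins (Finset.subset_insert z F) (Finset.mem_insert_self z F)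
  simpa using hz z hzF

variable [DecidableEq ι] [∀ i, Fintype (β i)]

lemma sum_pow_hammingDist {R : Type*} [CommSemiring R] (x : ∀ i, β i) (a : R) :
    ∑ z, a ^ hammingDist x z = ∏ i, (1 + (Fintype.card (β i) - 1 : ℕ) * a) := by
  have hfactor (i : ι) :
      ∑ b, (if x i ≠ b then a else 1) = 1 + (Fintype.card (β i) - 1 : ℕ) * a := by
    rw [← Finset.add_sum_erase _ _ (Finset.mem_univ (x i)), if_neg (not_not.2 rfl),
      Finset.sum_congr rfl fun b hb => if_pos (Finset.ne_of_mem_erase hb).symm, Finset.sum_const,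
      Finset.card_erase_of_mem (Finset.mem_univ _), nsmul_eq_mul, Finset.card_univ]
  simp_rw [← hfactor, Finset.prod_univ_sum, Fintype.piFinset_univ, Finset.prod_ite,
    Finset.prod_const_one, mul_one, Finset.prod_const]
  rfl

lemma pow_mul_card_hammingBall_le (x : ∀ i, β i) (r : ℕ) {a : ℝ} (ha : 0 ≤ a) (ha1 : a ≤ 1) :
    a ^ r * Finset.card {z | hammingDist x z ≤ r} ≤
      ∏ i, (1 + (Fintype.card (β i) - 1 : ℕ) * a) := by
  calc a ^ r * Finset.card {z | hammingDist x z ≤ r}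
      = ∑ z with hammingDist x z ≤ r, a ^ r := by
        rw [Finset.sum_const, nsmul_eq_mul, mul_comm]
    _ ≤ ∑ z with hammingDist x z ≤ r, a ^ hammingDist x z :=
        Finset.sum_le_sum fun z hz => pow_le_pow_of_le_one ha ha1 (Finset.mem_filter.1 hz).2
    _ ≤ ∑ z, a ^ hammingDist x z :=
        Finset.sum_le_sum_of_subset_of_nonneg (Finset.filter_subset _ _) fun _ _ _ => by positivity
    _ = _ := sum_pow_hammingDist x a

variable (β) in
lemma exists_hammingDist_packing (r : ℕ) {a : ℝ} (ha : 0 ≤ a) (ha1 : a ≤ 1) :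
    ∃ F : Finset (∀ i, β i), (F : Set (∀ i, β i)).Pairwise (fun x y => r < hammingDist x y) ∧
      a ^ r * Fintype.card (∀ i, β i) ≤
        F.card * ∏ i, (1 + (Fintype.card (β i) - 1 : ℕ) * a) := by
  obtain ⟨F, hpack, hcover⟩ := exists_hammingDist_packing_and_cover β r
  refine ⟨F, hpack, ?_⟩
  have hcard : Fintype.card (∀ i, β i) ≤ ∑ x ∈ F, Finset.card {z | hammingDist x z ≤ r} := by
    rw [← Finset.card_univ]
    refine (Finset.card_le_card fun z _ => ?_).trans Finset.card_biUnion_le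
    simpa using hcover z
  calc a ^ r * Fintype.card (∀ i, β i)
      ≤ a ^ r * (∑ x ∈ F, Finset.card {z | hammingDist x z ≤ r} : ℕ) := by gcongr
    _ = ∑ x ∈ F, a ^ r * Finset.card {z | hammingDist x z ≤ r} := by
        rw [Nat.cast_sum, Finset.mul_sum]
    _ ≤ ∑ _x ∈ F, ∏ i, (1 + (Fintype.card (β i) - 1 : ℕ) * a) :=
        Finset.sum_le_sum fun x _ => pow_mul_card_hammingBall_le x r ha ha1
    _ = _ := by rw [Finset.sum_const, nsmul_eq_mul]

end GilbertVarshamov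

lemma exists_bool_packing_exp_le_card (ι : Type*) [Fintype ι] :
    ∃ F : Finset (ι → Bool), Real.exp (Fintype.card ι / 8) ≤ F.card ∧
      (F : Set (ι → Bool)).Pairwise fun x y => Fintype.card ι ≤ 8 * hammingDist x y := by
  classical
  set N := Fintype.card ι
  obtain ⟨F, hpack, hcard⟩ := exists_hammingDist_packing (fun _ : ι => Bool) (N / 8)
    (Real.exp_pos (-2)).le (Real.exp_le_one_iff.2 (by norm_num))
  refine ⟨F, ?_, hpack.mono' fun x y hxy => by omega⟩
  have hbase : Real.exp (3 / 8) * (1 + Real.exp (-2)) ≤ 2 := by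
    have h₁ : Real.exp (3 / 8) ≤ 8 / 5 := by
      convert Real.exp_bound_div_one_sub_of_interval (x := 3 / 8) _ _ using 1 <;> norm_num
    have h₂ : Real.exp (-2) ≤ 1 / 4 := by
      rw [Real.exp_neg, one_div, show (2 : ℝ) = (2 : ℕ) * 1 by norm_num, Real.exp_nat_mul]
      refine inv_anti₀ (by norm_num) ?_
      nlinarith [Real.add_one_le_exp 1]
    calc _ ≤ (8 / 5 : ℝ) * (1 + 1 / 4) := by gcongr
      _ = 2 := by norm_num
  have hradius : Real.exp (-(N / 4)) ≤ Real.exp (-2) ^ (N / 8) := by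
    rw [← Real.exp_nat_mul, Real.exp_le_exp]
    have : ((N / 8 : ℕ) : ℝ) ≤ N / 8 := Nat.cast_div_le
    linarith
  have hpos : 0 < (1 + Real.exp (-2)) ^ N := by positivity
  refine le_of_mul_le_mul_right ?_ hpos
  calc Real.exp (N / 8) * (1 + Real.exp (-2)) ^ N
      = Real.exp (-(N / 4)) * (Real.exp (3 / 8) * (1 + Real.exp (-2))) ^ N := by
        rw [mul_pow, ← Real.exp_nat_mul, ← mul_assoc, ← Real.exp_add]
        ring_nf
    _ ≤ Real.exp (-2) ^ (N / 8) * 2 ^ N := by gcongr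
    _ ≤ F.card * (1 + Real.exp (-2)) ^ N := by simpa [N] using hcard

section SingularValues

variable {𝕜 E F : Type*} [RCLike 𝕜] [NormedAddCommGroup E] [InnerProductSpace 𝕜 E]
  [FiniteDimensional 𝕜 E] [NormedAddCommGroup F] [InnerProductSpace 𝕜 F] [FiniteDimensional 𝕜 F]

lemma sum_sq_singularValues {ι : Type*} [Fintype ι] (T : E →ₗ[𝕜] F) (b : OrthonormalBasis ι 𝕜 E) :
    ∑ l ∈ Finset.range (Module.finrank 𝕜 E), T.singularValues l ^ 2 = ∑ i, ‖T (b i)‖ ^ 2 := by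
  rw [← Fin.sum_univ_eq_sum_range fun l => T.singularValues l ^ 2]
  simp_rw [T.sq_singularValues_fin rfl]
  rw [← T.isSymmetric_adjoint_comp_self.re_trace_eq_sum_eigenvalues rfl,
    LinearMap.trace_eq_sum_inner _ b, map_sum]
  refine Finset.sum_congr rfl fun i _ => ?_
  rw [LinearMap.comp_apply, LinearMap.adjoint_inner_right, inner_self_eq_norm_sq]

lemma sq_sum_singularValues_le (T : E →ₗ[𝕜] F) (n : ℕ) :
    (∑ l ∈ Finset.range n, T.singularValues l) ^ 2 ≤
      Module.finrank 𝕜 T.range * ∑ l ∈ Finset.range n, T.singularValues l ^ 2 := by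
  rw [← T.card_support_singularValues, ← Finset.sum_filter_ne_zero]
  refine sq_sum_le_card_mul_sum_sq.trans ?_
  gcongr
  · exact fun l hl => Finsupp.mem_support_iff.2 (Finset.mem_filter.1 hl).2
  · exact Finset.filter_subset _ _

end SingularValues

section NuclearNorm

variable {d₁ d₂ : ℕ} {X : Matrix (Fin d₁) (Fin d₂) ℝ}

lemma sq_nuclearNorm_le_rank_mul_sum_sq (X : Matrix (Fin d₁) (Fin d₂) ℝ) :
    nuclearNorm X ^ 2 ≤ X.rank * ∑ i, ∑ j, X i j ^ 2 := by
  have hrank : X.rank = Module.finrank ℝ (Matrix.toEuclideanLin X).range := by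
    rw [Matrix.toEuclideanLin_eq_toLin_orthonormal]
    exact X.rank_eq_finrank_range_toLin _ _
  have hfrob : ∑ l ∈ Finset.range d₂, (Matrix.toEuclideanLin X).singularValues l ^ 2 =
      ∑ i, ∑ j, X i j ^ 2 := by
    have h := sum_sq_singularValues (Matrix.toEuclideanLin X) (EuclideanSpace.basisFun (Fin d₂) ℝ)
    rw [finrank_euclideanSpace_fin] at h
    rw [h, Finset.sum_comm]
    refine Finset.sum_congr rfl fun j _ => ?_
    rw [EuclideanSpace.real_norm_sq_eq]
    simp [Matrix.toEuclideanLin]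
  rw [hrank, ← hfrob]
  exact sq_sum_singularValues_le _ _

lemma mem_smul_nuclearBall {a : ℝ} (ha : 0 < a) (hX : X.rank * ∑ i, ∑ j, X i j ^ 2 ≤ a ^ 2) :
    X ∈ a • nuclearBall d₁ d₂ := by
  rw [Set.mem_smul_set_iff_inv_smul_mem₀ ha.ne']
  have hrank : (a⁻¹ • X).rank = X.rank :=
    Matrix.rank_smul_of_mem_nonZeroDivisors X (mem_nonZeroDivisors_of_ne_zero (inv_ne_zero ha.ne'))
  refine (le_abs_self (nuclearNorm (a⁻¹ • X))).trans ((sq_le_one_iff_abs_le_one _).1 ?_)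
  calc nuclearNorm (a⁻¹ • X) ^ 2 ≤ X.rank * ∑ i, ∑ j, (a⁻¹ • X) i j ^ 2 :=
        hrank ▸ sq_nuclearNorm_le_rank_mul_sum_sq _
    _ = a⁻¹ ^ 2 * (X.rank * ∑ i, ∑ j, X i j ^ 2) := by
        simp only [Matrix.smul_apply, smul_eq_mul, mul_pow, ← Finset.mul_sum]
        ring
    _ ≤ a⁻¹ ^ 2 * a ^ 2 := by gcongr
    _ = 1 := by rw [← mul_pow, inv_mul_cancel₀ ha.ne', one_pow]

lemma mem_sqrt_smul_nuclearBall [NeZero d₁] [NeZero d₂] {r : ℕ} [NeZero r] {γ : ℝ} (hγ : 0 < γ)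
    (hX : ∀ i j, |X i j| ≤ γ) (hr : X.rank ≤ r) :
    X ∈ √(r * γ ^ 2 * d₁ * d₂) • nuclearBall d₁ d₂ := by
  have hpos (n : ℕ) [NeZero n] : (0 : ℝ) < n := Nat.cast_pos.2 (NeZero.pos n)
  have := hpos d₁
  have := hpos d₂
  have := hpos r
  refine mem_smul_nuclearBall (by positivity) ?_
  rw [Real.sq_sqrt (by positivity)]
  calc (X.rank : ℝ) * ∑ i, ∑ j, X i j ^ 2 ≤ r * ∑ _i : Fin d₁, ∑ _j : Fin d₂, γ ^ 2 := by
        gcongr ?_ * ∑ i, ∑ j, ?_ with i _ j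
        · exact_mod_cast hr
        · exact sq_le_sq' (neg_le_of_abs_le (hX i j)) (le_of_abs_le (hX i j))
    _ = r * γ ^ 2 * d₁ * d₂ := by
        simp
        ring

end NuclearNorm

section BalancedSign

variable {η ζ : Type*}

/-- The sign `1` or `-1` of a bit. -/
noncomputable def bitSign (s : Bool) : ℝ := if s then 1 else -1

/-- The sign vector made of the signs of the bits of `s`, their negatives, and a block of ones that
adjusts its length. Its sum does not depend on `s`. -/
noncomputable def balancedSign (s : η → Bool) : (η ⊕ η) ⊕ ζ → ℝ :=
  Sum.elim (Sum.elim (fun j => bitSign (s j)) fun j => -bitSign (s j)) 1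

lemma abs_bitSign (s : Bool) : |bitSign s| = 1 := by
  cases s <;> simp [bitSign]

lemma sq_bitSign_sub_bitSign (s t : Bool) :
    (bitSign s - bitSign t) ^ 2 = if s ≠ t then 4 else 0 := by
  cases s <;> cases t <;> norm_num [bitSign]

lemma abs_balancedSign (s : η → Bool) (a : (η ⊕ η) ⊕ ζ) : |balancedSign s a| = 1 := by
  rcases a with (j | j) | j <;> simp [balancedSign, abs_bitSign]

variable [Fintype η] [Fintype ζ]

lemma sum_balancedSign (s : η → Bool) :
    ∑ a : (η ⊕ η) ⊕ ζ, balancedSign s a = Fintype.card ζ := by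
  simp [balancedSign]

lemma sum_sq_balancedSign_sub_balancedSign (s t : η → Bool) :
    ∑ a : (η ⊕ η) ⊕ ζ, (balancedSign s a - balancedSign t a) ^ 2 = 8 * hammingDist s t := by
  have hneg (j : η) :
      (-bitSign (s j) - -bitSign (t j)) ^ 2 = (bitSign (s j) - bitSign (t j)) ^ 2 := by
    ring
  simp only [balancedSign, Fintype.sum_sum_type, Sum.elim_inl, Sum.elim_inr, hneg,
    sq_bitSign_sub_bitSign, Pi.one_apply, sub_self, ← Finset.sum_filter, Finset.sum_const,
    hammingDist, nsmul_eq_mul]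
  ring

end BalancedSign

lemma sum_hammingDist_slice {κ η α : Type*} [Fintype κ] [Fintype η] [DecidableEq α]
    (x y : κ × η → α) :
    ∑ b, hammingDist (fun q => x (b, q)) (fun q => y (b, q)) = hammingDist x y := by
  simp only [hammingDist, Finset.card_filter, Fintype.sum_prod_type]

lemma mul_sum_le_sum_comp {ι κ R : Type*} [Fintype ι] [Fintype κ] [DecidableEq κ] [Semiring R]
    [PartialOrder R] [IsOrderedRing R] {f : κ → R} (hf : 0 ≤ f) {ρ : ι → κ} {n : ℕ}
    (hρ : ∀ b, n ≤ Finset.card {i | ρ i = b}) : n * ∑ b, f b ≤ ∑ i, f (ρ i) := by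
  rw [← Finset.sum_fiberwise' Finset.univ ρ f, Finset.mul_sum]
  refine Finset.sum_le_sum fun b _ => ?_
  rw [Finset.sum_const, nsmul_eq_mul]
  exact mul_le_mul_of_nonneg_right (Nat.mono_cast (hρ b)) (hf b)

lemma div_le_card_fiber_ofNat {d B : ℕ} [NeZero B] (b : Fin B) :
    d / B ≤ Finset.card {i : Fin d | Fin.ofNat B i = b} := by
  have hq : d / B * B ≤ d := Nat.div_mul_le_self d B
  let φ (q : Fin (d / B)) : Fin d := Fin.castLE hq (finProdFinEquiv (q, b))
  have hφ : Function.Injective φ := (Fin.castLE_injective hq).comp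
    (finProdFinEquiv.injective.comp (Prod.mk_left_injective b))
  have hmem (q : Fin (d / B)) : Fin.ofNat B (φ q) = b := by
    ext
    simp [φ, Nat.mod_eq_of_lt b.2]
  calc d / B = (Finset.univ : Finset (Fin (d / B))).card := (Finset.card_fin _).symm
    _ ≤ _ := Finset.card_le_card_of_injOn φ
      (fun q _ => Finset.mem_coe.2 ((Finset.mem_filter_univ _).2 (hmem q))) hφ.injOn

lemma le_two_mul_div_mul {d B : ℕ} [NeZero B] (hB : B ≤ d) : d ≤ 2 * (d / B) * B := by
  have := Nat.lt_div_mul_add (a := d) (NeZero.pos B)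
  have := Nat.div_pos hB (NeZero.pos B)
  nlinarith

section CodeMatrix

variable {m n κ η ζ : Type*} (ρ : m → κ) (e : n ≃ (η ⊕ η) ⊕ ζ)

/-- The sign matrix whose row `i` is the balanced sign vector coded by the slice `x (ρ i, ·)`. Rows
are repeated along `ρ`, so that its rank is at most the number of slices. -/
noncomputable def codeMatrix (x : κ × η → Bool) : Matrix m n ℝ :=
  Matrix.of fun i j => balancedSign (fun q => x (ρ i, q)) (e j)

lemma abs_codeMatrix (x : κ × η → Bool) (i : m) (j : n) : |codeMatrix ρ e x i j| = 1 :=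
  abs_balancedSign _ _

variable [Fintype n]

lemma rank_codeMatrix_le [Fintype κ] (x : κ × η → Bool) :
    (codeMatrix ρ e x).rank ≤ Fintype.card κ :=
  (Matrix.rank_submatrix_le (.of fun b j => balancedSign (fun q => x (b, q)) (e j)) ρ id).trans
    (Matrix.rank_le_card_height _)

lemma sum_codeMatrix [Finite η] [Fintype ζ] (x : κ × η → Bool) (i : m) :
    ∑ j, codeMatrix ρ e x i j = Fintype.card ζ := by
  cases nonempty_fintype η
  exact (e.sum_comp _).trans (sum_balancedSign _)

variable [Fintype η] [Finite ζ]

lemma sum_sq_codeMatrix_sub_codeMatrix (x y : κ × η → Bool) (i : m) :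
    ∑ j, (codeMatrix ρ e x i j - codeMatrix ρ e y i j) ^ 2 =
      8 * hammingDist (fun q => x (ρ i, q)) (fun q => y (ρ i, q)) := by
  cases nonempty_fintype ζ
  rw [← sum_sq_balancedSign_sub_balancedSign (ζ := ζ), ← e.sum_comp]
  rfl

lemma mul_hammingDist_le_sum_sq_codeMatrix_sub [Fintype m] [Fintype κ] [DecidableEq κ] {k : ℕ}
    (hρ : ∀ b, k ≤ Finset.card {i | ρ i = b}) (x y : κ × η → Bool) :
    k * (8 * hammingDist x y) ≤ ∑ i, ∑ j, (codeMatrix ρ e x i j - codeMatrix ρ e y i j) ^ 2 := by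
  simp_rw [sum_sq_codeMatrix_sub_codeMatrix]
  rw [← sum_hammingDist_slice, Nat.cast_sum, Finset.mul_sum]
  exact mul_sum_le_sum_comp (f := fun b => 8 * (hammingDist _ _ : ℝ)) (fun b => by positivity) hρ

end CodeMatrix

lemma exists_signMatrix_packing {d₁ d₂ B : ℕ} [NeZero B] (hB : B ≤ d₁) (hd₂ : 2 ≤ d₂) {γ : ℝ}
    (hγ : 0 < γ) :
    ∃ S : Finset (Matrix (Fin d₁) (Fin d₂) ℝ), Real.exp (B * d₂ / 24) ≤ S.card ∧
      (∀ X ∈ S, (∀ i j, |X i j| = γ) ∧ X.rank ≤ B) ∧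
      (∀ X ∈ S, ∀ Y ∈ S, ∀ i, ∑ j, X i j = ∑ j, Y i j) ∧
      (S : Set (Matrix (Fin d₁) (Fin d₂) ℝ)).Pairwise fun X Y =>
        γ ^ 2 / 6 * (d₁ * d₂) ≤ ∑ i, ∑ j, (X i j - Y i j) ^ 2 := by
  classical
  set h := d₂ / 2
  have e : Fin d₂ ≃ (Fin h ⊕ Fin h) ⊕ Fin (d₂ % 2) := Fintype.equivOfCardEq (by simp; omega)
  have hdh : (d₂ : ℝ) ≤ 3 * h := by exact_mod_cast (by omega : d₂ ≤ 3 * h)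
  obtain ⟨F, hcard, hpack⟩ := exists_bool_packing_exp_le_card (Fin B × Fin h)
  rw [Fintype.card_prod, Fintype.card_fin, Fintype.card_fin] at hcard hpack
  let M (x : Fin B × Fin h → Bool) : Matrix (Fin d₁) (Fin d₂) ℝ :=
    γ • codeMatrix (fun i : Fin d₁ => Fin.ofNat B i) e x
  have hsep {x y : Fin B × Fin h → Bool} (hx : x ∈ F) (hy : y ∈ F) (hxy : x ≠ y) :
      γ ^ 2 / 6 * (d₁ * d₂) ≤ ∑ i, ∑ j, (M x i j - M y i j) ^ 2 := by
    have hdist : (B * h : ℝ) ≤ 8 * hammingDist x y := by exact_mod_cast hpack hx hy hxy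
    have hrows : (d₁ : ℝ) ≤ 2 * (d₁ / B : ℕ) * B := by exact_mod_cast le_two_mul_div_mul hB
    simp only [M, Matrix.smul_apply, smul_eq_mul, ← mul_sub, mul_pow, ← Finset.mul_sum]
    rw [div_mul_eq_mul_div, mul_div_assoc]
    gcongr
    refine le_trans ?_ (mul_hammingDist_le_sum_sq_codeMatrix_sub _ e div_le_card_fiber_ofNat x y)
    calc (d₁ * d₂ / 6 : ℝ) ≤ (2 * (d₁ / B : ℕ) * B) * (3 * h) / 6 := by gcongr
      _ = (d₁ / B : ℕ) * (B * h : ℝ) := by ring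
      _ ≤ _ := by gcongr
  have hinj : Set.InjOn M F := by
    intro x hx y hy hxy
    by_contra hne
    have hpos : 0 < γ ^ 2 / 6 * (d₁ * d₂) := by
      have : 0 < d₁ := (NeZero.pos B).trans_le hB
      positivity
    simpa [hxy, hpos.not_ge] using hsep hx hy hne
  refine ⟨F.image M, ?_, ?_, ?_, ?_⟩
  · rw [Finset.card_image_of_injOn hinj]
    refine (Real.exp_le_exp.2 ?_).trans hcard
    push_cast
    nlinarith [mul_le_mul_of_nonneg_left hdh B.cast_nonneg]
  · simp only [Finset.forall_mem_image]
    refine fun x _ => ⟨fun i j => ?_, ?_⟩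
    · simp [M, abs_mul, abs_codeMatrix, abs_of_pos hγ]
    · rw [Matrix.rank_smul_of_mem_nonZeroDivisors _ (mem_nonZeroDivisors_of_ne_zero hγ.ne')]
      simpa using rank_codeMatrix_le _ e x
  · simp only [Finset.forall_mem_image]
    intro x _ y _ i
    simp only [M, Matrix.smul_apply, ← Finset.smul_sum, sum_codeMatrix]
  · rw [Finset.coe_image]
    exact hinj.pairwise_image.2 fun x hx y hy hxy => hsep hx hy hxy

section SymmSlope

open Filter Topology

/-- The symmetric difference quotient of `f` at `0` with step `h`. -/
noncomputable def symmSlope (f : ℝ → ℝ) (h : ℝ) : ℝ := (f h - f (-h)) / (2 * h)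

lemma tendsto_symmSlope {f : ℝ → ℝ} {f' : ℝ} (hf : HasDerivAt f f' 0) :
    Tendsto (symmSlope f) (𝓝[≠] 0) (𝓝 f') := by
  have hneg : HasDerivAt (fun h => f (-h)) (-f') 0 := by
    simpa [Function.comp_def] using HasDerivAt.scomp_of_eq 0 hf (hasDerivAt_neg 0) neg_zero.symm
  have hslope := ((hf.sub hneg).tendsto_slope_zero).div_const 2
  rw [sub_neg_eq_add, add_self_div_two] at hslope
  refine hslope.congr fun h => ?_
  simp [symmSlope]
  ring

lemma eq_quadratic_symmSlope (f : ℝ → ℝ) {h x : ℝ} (hh : h ≠ 0) (hx : x = 0 ∨ x = h ∨ x = -h) :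
    f x = f 0 + symmSlope f h * x + ((f h + f (-h)) / 2 - f 0) / h ^ 2 * x ^ 2 := by
  rw [symmSlope]
  rcases hx with rfl | rfl | rfl <;> field_simp <;> ring

lemma sigmoid_eq_half_add_symmSlope {h x : ℝ} (hh : h ≠ 0) (hx : x = 0 ∨ x = h ∨ x = -h) :
    Real.sigmoid x = 1 / 2 + symmSlope Real.sigmoid h * x := by
  rw [eq_quadratic_symmSlope Real.sigmoid hh hx, Real.sigmoid_neg, Real.sigmoid_zero]
  ring

lemma eventually_abs_deriv_lt_symmSlope_mul {L : ℝ → ℝ} (hL : deriv L 0 < 0) :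
    ∀ᶠ γ in 𝓝[>] (0 : ℝ),
      |deriv L 0| / 4 < -2 * symmSlope Real.sigmoid (2 * γ) * symmSlope L (2 * γ) := by
  have hL' := tendsto_symmSlope (differentiableAt_of_deriv_ne_zero hL.ne).hasDerivAt
  have hσ := tendsto_symmSlope (Real.hasDerivAt_sigmoid 0)
  have hlim := ((hσ.const_mul (-2)).mul hL').eventually_const_lt (u := |deriv L 0| / 4) (by
    rw [Real.sigmoid_zero, abs_of_neg hL]
    linarith)
  have hdouble : Tendsto (fun γ : ℝ => 2 * γ) (𝓝[>] 0) (𝓝[≠] 0) :=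
    tendsto_nhdsWithin_iff.2 ⟨by
      simpa using ((continuous_const_mul (2 : ℝ)).tendsto 0).mono_left nhdsWithin_le_nhds,
      eventually_nhdsWithin_of_forall fun γ hγ => (mul_pos two_pos hγ).ne'⟩
  exact hdouble.eventually hlim

lemma exists_forall_abs_deriv_lt_symmSlope_mul {L : ℝ → ℝ} (hL : deriv L 0 < 0) :
    ∃ γ₀ > 0, ∀ γ, 0 < γ → γ < γ₀ →
      |deriv L 0| / 4 < -2 * symmSlope Real.sigmoid (2 * γ) * symmSlope L (2 * γ) := by
  obtain ⟨γ₀, hγ₀, h⟩ := mem_nhdsGT_iff_exists_Ioo_subset.1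
    (eventually_abs_deriv_lt_symmSlope_mul hL)
  exact ⟨γ₀, hγ₀, fun γ hγ hγγ₀ => h ⟨hγ, hγγ₀⟩⟩

end SymmSlope

section DoubleSums

variable {ι R : Type*} [Fintype ι] [CommRing R] {a b : ι → R}

lemma sum_sum_sub_mul_sub (a b : ι → R) :
    ∑ j, ∑ k, (a j - a k) * (b j - b k) =
      2 * (Fintype.card ι * ∑ j, a j * b j - (∑ j, a j) * ∑ j, b j) := by
  simp only [sub_mul, mul_sub, Finset.sum_sub_distrib, Finset.sum_const, Finset.card_univ,
    nsmul_eq_mul, ← Finset.mul_sum, ← Finset.sum_mul]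
  ring

lemma sum_sum_sq_sub_eq (hsum : ∑ j, a j = ∑ j, b j) (hsq : ∑ j, a j ^ 2 = ∑ j, b j ^ 2) :
    ∑ j, ∑ k, (a j - a k) ^ 2 = ∑ j, ∑ k, (b j - b k) ^ 2 := by
  simp only [sq, sum_sum_sub_mul_sub] at hsq ⊢
  rw [hsum, hsq]

lemma sum_sum_sub_mul_sub_sub (hsum : ∑ j, a j = ∑ j, b j)
    (hsq : ∑ j, a j ^ 2 = ∑ j, b j ^ 2) :
    ∑ j, ∑ k, (a j - a k) * ((b j - b k) - (a j - a k)) =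
      -(Fintype.card ι * ∑ j, (a j - b j) ^ 2) := by
  have hpolar : 2 * ∑ j, a j * (b j - a j) = -∑ j, (a j - b j) ^ 2 :=
    calc 2 * ∑ j, a j * (b j - a j)
        = ∑ j, (2 * (a j * (b j - a j)) + (a j ^ 2 - b j ^ 2)) := by
          rw [Finset.sum_add_distrib, Finset.sum_sub_distrib, hsq, sub_self, add_zero,
            Finset.mul_sum]
      _ = -∑ j, (a j - b j) ^ 2 := by
          rw [← Finset.sum_neg_distrib]
          exact Finset.sum_congr rfl fun j _ => by ring
  simp_rw [sub_sub_sub_comm (b _)]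
  rw [sum_sum_sub_mul_sub a fun j => b j - a j, Finset.sum_sub_distrib (s := Finset.univ) b a, hsum,
    sub_self, mul_zero, sub_zero, mul_left_comm, hpolar, mul_neg]

end DoubleSums

section ExcessLoss

variable {d₁ d₂ : ℕ} {X₁ X₂ : Matrix (Fin d₁) (Fin d₂) ℝ} {γ : ℝ}

lemma sub_eq_of_abs_eq {a b : ℝ} (ha : |a| = γ) (hb : |b| = γ) :
    a - b = 0 ∨ a - b = 2 * γ ∨ a - b = -(2 * γ) := by
  rcases eq_or_eq_neg_of_abs_eq ha with rfl | rfl <;>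
    rcases eq_or_eq_neg_of_abs_eq hb with rfl | rfl <;> grind

lemma integral_outcomeLaw (X : Matrix (Fin d₁) (Fin d₂) ℝ) (t : Triple d₁ d₂) (f : ℤ → ℝ) :
    ∫ y, f y ∂outcomeLaw X t =
      Real.sigmoid (scoreDiff X t) * f 1 + (1 - Real.sigmoid (scoreDiff X t)) * f (-1) := by
  rw [outcomeLaw, integral_bernoulliMeasure]
  rfl

lemma integral_loss_sub_loss_outcomeLaw (hγ : γ ≠ 0) (hX₁ : ∀ i j, |X₁ i j| = γ)
    (hX₂ : ∀ i j, |X₂ i j| = γ) (L : ℝ → ℝ) (i : Fin d₁) (j k : Fin d₂) :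
    ∫ y, (L ((y : ℝ) * (X₂ i j - X₂ i k)) - L ((y : ℝ) * (X₁ i j - X₁ i k)))
        ∂outcomeLaw X₁ (i, j, k) =
      2 * symmSlope Real.sigmoid (2 * γ) * symmSlope L (2 * γ) *
          ((X₁ i j - X₁ i k) * ((X₂ i j - X₂ i k) - (X₁ i j - X₁ i k))) +
        ((L (2 * γ) + L (-(2 * γ))) / 2 - L 0) / (2 * γ) ^ 2 *
          ((X₂ i j - X₂ i k) ^ 2 - (X₁ i j - X₁ i k) ^ 2) := by
  have h2γ : 2 * γ ≠ 0 := mul_ne_zero two_ne_zero hγ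
  have h₁ := sub_eq_of_abs_eq (hX₁ i j) (hX₁ i k)
  have h₂ := sub_eq_of_abs_eq (hX₂ i j) (hX₂ i k)
  have h₁' := sub_eq_of_abs_eq (hX₁ i k) (hX₁ i j)
  have h₂' := sub_eq_of_abs_eq (hX₂ i k) (hX₂ i j)
  rw [integral_outcomeLaw]
  simp only [scoreDiff, Int.cast_one, one_mul, Int.cast_neg, neg_one_mul, neg_sub]
  rw [sigmoid_eq_half_add_symmSlope h2γ h₁, eq_quadratic_symmSlope L h2γ h₁,
    eq_quadratic_symmSlope L h2γ h₂, eq_quadratic_symmSlope L h2γ h₁',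
    eq_quadratic_symmSlope L h2γ h₂']
  ring

lemma averageExcessLoss_eq (hγ : γ ≠ 0) (hX₁ : ∀ i j, |X₁ i j| = γ) (hX₂ : ∀ i j, |X₂ i j| = γ)
    (hsum : ∀ i, ∑ j, X₁ i j = ∑ j, X₂ i j) (L : ℝ → ℝ) :
    averageExcessLoss L X₁ X₂ =
      -2 * symmSlope Real.sigmoid (2 * γ) * symmSlope L (2 * γ) / (d₁ * d₂) *
        ∑ i, ∑ j, (X₁ i j - X₂ i j) ^ 2 := by
  have hsq (i : Fin d₁) : ∑ j, X₁ i j ^ 2 = ∑ j, X₂ i j ^ 2 :=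
    Finset.sum_congr rfl fun j _ => by rw [← sq_abs, hX₁, ← hX₂ i j, sq_abs]
  rw [averageExcessLoss]
  simp_rw [integral_loss_sub_loss_outcomeLaw hγ hX₁ hX₂, Finset.sum_add_distrib, ← Finset.mul_sum,
    Finset.sum_sub_distrib, sum_sum_sq_sub_eq (hsum _) (hsq _)]
  simp only [sum_sum_sub_mul_sub_sub (hsum _) (hsq _), Finset.sum_neg_distrib, ← Finset.mul_sum,
    Fintype.card_fin, sub_self]
  rcases Nat.eq_zero_or_pos d₂ with rfl | hd
  · simp
  · field_simp
    ring

lemma mul_le_averageExcessLoss [NeZero d₁] [NeZero d₂] (hγ : γ ≠ 0) (hX₁ : ∀ i j, |X₁ i j| = γ)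
    (hX₂ : ∀ i j, |X₂ i j| = γ) (hsum : ∀ i, ∑ j, X₁ i j = ∑ j, X₂ i j) {L : ℝ → ℝ} {a r : ℝ}
    (ha₀ : 0 ≤ a) (ha : a ≤ -2 * symmSlope Real.sigmoid (2 * γ) * symmSlope L (2 * γ))
    (hr : r * (d₁ * d₂) ≤ ∑ i, ∑ j, (X₁ i j - X₂ i j) ^ 2) :
    a * r ≤ averageExcessLoss L X₁ X₂ := by
  have := NeZero.ne (d₁ : ℝ)
  have := NeZero.ne (d₂ : ℝ)
  rw [averageExcessLoss_eq hγ hX₁ hX₂ hsum]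
  calc a * r = a / (d₁ * d₂) * (r * (d₁ * d₂)) := by field_simp
    _ ≤ a / (d₁ * d₂) * ∑ i, ∑ j, (X₁ i j - X₂ i j) ^ 2 := by gcongr
    _ ≤ _ := by gcongr

end ExcessLoss

theorem mainTheorem2 :
    ∃ c C : ℝ, 0 < c ∧ c < C ∧
      ∀ L : ℝ → ℝ, deriv L 0 < 0 →
        ∃ γ₀ : ℝ, 0 < γ₀ ∧
          ∀ γ : ℝ, 0 < γ → γ < γ₀ →
          ∀ (lam : ℝ) (d₁ d₂ B : ℕ), 0 < lam → (B : ℝ) = lam * (γ ^ 2)⁻¹ → B ≤ d₁ → 2 ≤ d₂ →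
            ∃ S : Finset (Matrix (Fin d₁) (Fin d₂) ℝ),
              (∀ X ∈ S, X ∈ Real.sqrt (lam * d₁ * d₂) • nuclearBall d₁ d₂) ∧
              Real.exp (c * B * d₂) ≤ (S.card : ℝ) ∧
              (∀ X₁ ∈ S, ∀ X₂ ∈ S, X₁ ≠ X₂ →
                c * |deriv L 0| * γ ^ 2 ≤ averageExcessLoss L X₁ X₂) ∧
              (∀ X₁ ∈ S, ∀ X₂ ∈ S,
                (∀ (m : ℝ) (ν : Measure (Set (Triple d₁ d₂))), IsUniformSetSampling ν m →
                  klDiv (setSampleLaw ν X₁) (setSampleLaw ν X₂)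
                    ≤ ENNReal.ofReal (C * m * γ ^ 2)) ∧
                (∀ m : ℕ,
                  klDiv (iidSampleLaw m X₁) (iidSampleLaw m X₂)
                    ≤ ENNReal.ofReal (C * m * γ ^ 2))) := by
  refine ⟨1 / 24, 4, by norm_num, by norm_num, fun L hL => ?_⟩
  obtain ⟨γ₀, hγ₀, hslope⟩ := exists_forall_abs_deriv_lt_symmSlope_mul hL
  refine ⟨γ₀, hγ₀, fun γ hγ hγγ₀ lam d₁ d₂ B hlam hBlam hB hd₂ => ?_⟩
  have : NeZero B := ⟨fun h => by simp [h, hlam.ne', hγ.ne'] at hBlam⟩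
  have : NeZero d₁ := .of_pos ((NeZero.pos B).trans_le hB)
  have : NeZero d₂ := .of_pos (two_pos.trans_le hd₂)
  have hlamB : lam = B * γ ^ 2 := by rw [hBlam, inv_mul_cancel_right₀ (pow_ne_zero 2 hγ.ne')]
  obtain ⟨S, hcard, hS, hsum, hsep⟩ := exists_signMatrix_packing hB hd₂ hγ
  have hle {X} (hX : X ∈ S) (i j) : |X i j| ≤ γ := ((hS X hX).1 i j).le
  refine ⟨S, fun X hX => ?_, hcard.trans' (by gcongr; linarith), fun X₁ hX₁ X₂ hX₂ hne => ?_,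
    fun X₁ hX₁ X₂ hX₂ => ⟨fun m ν hν => ?_, fun m => ?_⟩⟩
  · rw [hlamB]
    exact mem_sqrt_smul_nuclearBall hγ (hle hX) (hS X hX).2
  · have hexcess := mul_le_averageExcessLoss hγ.ne' (hS X₁ hX₁).1 (hS X₂ hX₂).1
      (hsum X₁ hX₁ X₂ hX₂) (by positivity) (hslope γ hγ hγγ₀).le (hsep hX₁ hX₂ hne)
    linarith
  · exact (klDiv_setSampleLaw X₁ X₂ hν).trans_le (mul_sum_klDiv_outcomeLaw_le (hle hX₁) (hle hX₂) m)
  · exact (klDiv_iidSampleLaw X₁ X₂ m).trans_le (mul_sum_klDiv_outcomeLaw_le (hle hX₁) (hle hX₂) m)
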